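/- Let $d\ge 2$ and let $H$ be a real inner product space of dimension $d$ with closed unit ball $B$ and unit sphere $S$. A set $X$ is called an inner $\epsilon$-approximation of $B$ if $X$ is a finite subset of $S$ with $0\in\operatorname{conv}(X)$, $\epsilon>0$, and $\frac{1}{1+\epsilon}B\subset\operatorname{conv}(X)$. For an $m$-simplex with ordered vertices $v_0,\dots,v_m$ and an integer $n\ge1$, the edgewise subdivision consists of the following $n^m$ simplices, one for each map $r:\{1,\dots,m\}\to\{1,\dots,n\}$: for $1\le i\le n$ and $0\le j\le m$ put $\chi_r(i,j)=\#\{t: r(t)<i\}+\#\{t\le j: r(t)=i\}$; the simplex belonging to $r$ has the vertices $\frac1n\sum_{i=1}^n v_{\chi_r(i,j)}$, $j=0,\dots,m$. **Theorem.** Let $X\subset S$ be an inner $\epsilon$-approximation of $B$, and let $\mathcal K$ be a finite simplicial complex that triangulates the facets of the polytope $P=\operatorname{conv}(X)$ (each simplex lies in a facet of $P$, and each facet of $P$ is the union of the simplices that it contains), such that every maximal simplex of $\mathcal K$, which is a $(d-1)$-simplex, contains its own circumcenter. Let $n\ge2$. Choose an ordering of the vertices of each maximal simplex of $\mathcal K$,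 subdivide each of these simplices edgewise into $n^{d-1}$ subsimplices, and let $X_n\subset S$ be the set of all vertices of the subsimplices, projected radially onto $S$ by $x\mapsto x/\|x\|$. Let $D_n$ be the maximal diameter of the subsimplices (before projection). Then $X_n$ is an inner $\epsilon_n$-approximation of $B$, where $\epsilon_n>0$ is determined by $$(1+\epsilon_n)^2=1+\frac{d-1}{2d}\,D_n^2\,(1+\epsilon)^2 .$$ -/

import Mathlib

/-- `X` is an inner `ε`-approximation of the convex set `K`: `X` is a finite set of extreme points
of `K` whose convex hull contains `0`, `ε` is positive, and `(1 + ε)⁻¹ K ⊆ conv X`. -/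
structure IsInnerApproximation {E : Type*} [NormedAddCommGroup E] [InnerProductSpace ℝ E]
    (K X : Set E) (ε : ℝ) : Prop where
  finite : X.Finite
  subset_extremePoints : X ⊆ Set.extremePoints ℝ K
  zero_mem : (0 : E) ∈ convexHull ℝ X
  pos : 0 < ε
  subset_convexHull : (fun x : E => (1 / (1 + ε)) • x) '' K ⊆ convexHull ℝ X

/-- `F` is a facet of `P`: a nonempty exposed face whose dimension is one less than that of `P`. -/
structure IsFacet {E : Type*} [NormedAddCommGroup E] [InnerProductSpace ℝ E]
    (P F : Set E) : Prop where
  isExposed : IsExposed ℝ P F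
  nonempty : F.Nonempty
  finrank_add_one : Module.finrank ℝ (vectorSpan ℝ F) + 1 = Module.finrank ℝ (vectorSpan ℝ P)

/-- The finite simplicial complex `K` triangulates the facets of `P`: every simplex of `K` lies in
a facet of `P`, and every facet of `P` is covered by the simplices of `K` that it contains. -/
structure TriangulatesFacets {E : Type*} [NormedAddCommGroup E] [InnerProductSpace ℝ E]
    (K : Geometry.SimplicialComplex ℝ E) (P : Set E) : Prop where
  finite : K.faces.Finite
  subset_facet : ∀ s ∈ K.faces, ∃ F, IsFacet P F ∧ convexHull ℝ (s : Set E) ⊆ F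
  cover : ∀ F, IsFacet P F → ∀ x ∈ F,
    ∃ s ∈ K.faces, convexHull ℝ (s : Set E) ⊆ F ∧ x ∈ convexHull ℝ (s : Set E)

/-- The colour schemes of the edgewise subdivision of an `m`-simplex into `n ^ m` pieces.
A piece is given by a map `r` from the `m` column steps to the `n` rows. Its colour scheme is the
`n × (m + 1)` matrix that starts with the colour `0`, is read row by row, increases by one from
column `t` to column `t + 1` exactly in the row `r t`, and begins every row with the last colour
of the row before. So the entry `(i, j)` is the number of increases that precede it. -/
def edgewiseColor {m n : ℕ} (r : Fin m → Fin n) (i : Fin n) (j : Fin (m + 1)) : Fin (m + 1) :=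
  ⟨(Finset.univ.filter fun t : Fin m => r t < i ∨ (r t = i ∧ t.castSucc < j)).card,
    Nat.lt_succ_of_le ((Finset.card_le_univ _).trans_eq (Fintype.card_fin m))⟩

/-- The `j`-th vertex of the piece `r` in the edgewise subdivision of the simplex with the ordered
vertices `σ.points 0, …, σ.points m`: the mean of the vertices of `σ` whose colours stand in the
`j`-th column of the colour scheme. -/
noncomputable def edgewiseVertex {E : Type*} [NormedAddCommGroup E] [InnerProductSpace ℝ E]
    {m n : ℕ} (σ : Affine.Simplex ℝ E m) (r : Fin m → Fin n) (j : Fin (m + 1)) : E :=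
  (1 / (n : ℝ)) • ∑ i : Fin n, σ.points (edgewiseColor r i j)

/-- The piece `r` of the edgewise subdivision of `σ`, as a set. -/
noncomputable def edgewisePiece {E : Type*} [NormedAddCommGroup E] [InnerProductSpace ℝ E]
    {m n : ℕ} (σ : Affine.Simplex ℝ E m) (r : Fin m → Fin n) : Set E :=
  convexHull ℝ (Set.range (edgewiseVertex σ r))

/-- The vertices of the edgewise subdivisions of all the simplices `σ s` into `n ^ m` pieces each,
projected radially onto the unit sphere. -/
def projectedVertices {E : Type*} [NormedAddCommGroup E] [InnerProductSpace ℝ E]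
    {ι : Type*} {m : ℕ} (σ : ι → Affine.Simplex ℝ E m) (n : ℕ) : Set E :=
  {x | ∃ (s : ι) (r : Fin m → Fin n) (j : Fin (m + 1)),
    x = (1 / ‖edgewiseVertex (σ s) r j‖) • edgewiseVertex (σ s) r j}

/-- The diameters of the pieces of the edgewise subdivisions of all the simplices `σ s`. -/
def pieceDiameters {E : Type*} [NormedAddCommGroup E] [InnerProductSpace ℝ E]
    {ι : Type*} {m : ℕ} (σ : ι → Affine.Simplex ℝ E m) (n : ℕ) : Set ℝ :=
  {δ | ∃ (s : ι) (r : Fin m → Fin n), δ = Metric.diam (edgewisePiece (σ s) r)}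

/-!
Every ray from the origin meets a facet of `P = conv X`, hence a maximal simplex of the
triangulation, hence a piece of its edgewise subdivision, at a point `y = ∑ μ j • w j` with
`w j` the vertices of the piece. Radial projection of the vertices replaces `y` by the point
`y / ∑ μ j * ‖w j‖` of the same ray, which lies in the convex hull of the projected vertices
(`inv_sum_mul_norm_smul_mem_convexHull`). It therefore suffices to bound the mean norm. By
convexity of the square its square is at most
`∑ μ j * ‖w j‖ ^ 2 = ‖y‖ ^ 2 + 1 / 2 * ∑ i, ∑ j, μ i * μ j * ‖w i - w j‖ ^ 2`, and the last term
is at most `(d - 1) / (2 * d) * D ^ 2`, because the mutual distances are at most `D` and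
`∑ μ j ^ 2 ≥ 1 / d` (`sq_sum_mul_norm_le`). Division by `‖y‖ ^ 2`, where `‖y‖ ≥ 1 / (1 + ε)` since
`y` lies on a facet (`IsFacet.le_norm`), gives the constant of the theorem.

Two covering facts carry the argument.

* Every ray meets a facet (`exists_isFacet_smul_mem`). The linear functional given by the direction
  of the ray attains its maximum over the polar polytope at an extreme point, and the tight
  constraints at an extreme point span the space, so that they cut out a facet.
* The pieces of the edgewise subdivision cover the simplex (`exists_mem_edgewisePiece`). A point
  with barycentric coordinates `λ` is the mean of a step function on `[0, n]` with values the
  vertices in order, the `k`-th on an interval of length `n * λ k`. Cutting `[0, n]` into `n` rows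
  of length one and sorting the fractional parts of the breakpoints splits all rows into the same
  columns; the step function is then the colour scheme of a piece, and the widths of the columns
  are the barycentric coordinates of the point in that piece.
-/

/-! ### Edgewise subdivisions cover the simplex -/

theorem Fin.val_lt_card_filter_iff {m : ℕ} (p : Fin m → Prop) [DecidablePred p]
    (hp : ∀ a b, a ≤ b → p b → p a) (k : Fin m) :
    (k : ℕ) < (Finset.univ.filter p).card ↔ p k := by
  constructor
  · intro h
    by_contra hk
    have hsub : Finset.univ.filter p ⊆ Finset.Iio k := by
      intro a ha
      rw [Finset.mem_filter] at ha
      rw [Finset.mem_Iio]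
      by_contra hka
      exact hk (hp k a (not_lt.1 hka) ha.2)
    have := Finset.card_le_card hsub
    rw [Fin.card_Iio] at this
    omega
  · intro hk
    have hsub : Finset.Iic k ⊆ Finset.univ.filter p := by
      intro a ha
      rw [Finset.mem_Iic] at ha
      exact Finset.mem_filter.2 ⟨Finset.mem_univ _, hp a k ha hk⟩
    have := Finset.card_le_card hsub
    rw [Fin.card_Iic] at this
    omega

/-- Listing the column steps of a colour scheme in reading order, by row and then by column, the
colour at an entry exceeds `k` exactly when the `k`-th step in that order precedes the entry. -/
theorem exists_perm_lt_edgewiseColor {m n : ℕ} (r : Fin m → Fin n) :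
    ∃ π : Equiv.Perm (Fin m),
      (∀ k l, k ≤ l → r (π k) < r (π l) ∨ (r (π k) = r (π l) ∧ π k ≤ π l)) ∧
      ∀ i j k, k.castSucc < edgewiseColor r i j ↔
        r (π k) < i ∨ (r (π k) = i ∧ (π k).castSucc < j) := by
  set f : Fin m → Fin n ×ₗ Fin m := fun t => toLex (r t, t) with hf
  have hmono := Tuple.monotone_sort f
  have hle : ∀ k l, k ≤ l → r (Tuple.sort f k) < r (Tuple.sort f l) ∨
      (r (Tuple.sort f k) = r (Tuple.sort f l) ∧ Tuple.sort f k ≤ Tuple.sort f l) := by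
    intro k l hkl
    simpa [hf, Prod.Lex.toLex_le_toLex] using hmono hkl
  refine ⟨Tuple.sort f, hle, fun i j k => ?_⟩
  have hcard : (edgewiseColor r i j : ℕ) = (Finset.univ.filter fun k : Fin m =>
      r (Tuple.sort f k) < i ∨ (r (Tuple.sort f k) = i ∧ (Tuple.sort f k).castSucc < j)).card := by
    symm
    simp only [edgewiseColor]
    exact Finset.card_equiv (Tuple.sort f) fun a => by simp
  rw [Fin.lt_def, Fin.val_castSucc, hcard]
  refine Fin.val_lt_card_filter_iff (fun k : Fin m =>
      r (Tuple.sort f k) < i ∨ (r (Tuple.sort f k) = i ∧ (Tuple.sort f k).castSucc < j)) ?_ k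
  intro a b hab hb
  rcases hle a b hab with h | ⟨h, h'⟩
  · rcases hb with hb | hb
    · exact Or.inl (h.trans hb)
    · exact Or.inl (hb.1 ▸ h)
  · rcases hb with hb | hb
    · exact Or.inl (h ▸ hb)
    · exact Or.inr ⟨h.trans hb.1, lt_of_le_of_lt (Fin.castSucc_le_castSucc_iff.2 h') hb.2⟩

theorem Fin.eq_zero_add_sum_ite_sub {G : Type*} [AddCommGroup G] {m : ℕ} (v : Fin (m + 1) → G)
    (a : Fin (m + 1)) :
    v a = v 0 + ∑ k : Fin m, if k.castSucc < a then v k.succ - v k.castSucc else 0 := by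
  induction a using Fin.induction with
  | zero => simp
  | succ a ih =>
    have h : ∀ k : Fin m, (if k.castSucc < a.succ then v k.succ - v k.castSucc else 0) =
        (if k.castSucc < a.castSucc then v k.succ - v k.castSucc else 0) +
          if k = a then v k.succ - v k.castSucc else 0 := by
      intro k
      rcases lt_trichotomy k a with h | h | h
      · have h1 : k.castSucc < a.succ := by rw [Fin.lt_def] at *; simp; omega
        have h2 : k.castSucc < a.castSucc := by rw [Fin.lt_def] at *; simpa
        simp [h1, h2, h.ne]
      · subst h
        simp
      · have h1 : ¬ k.castSucc < a.succ := by rw [Fin.lt_def] at *; simp; omega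
        have h2 : ¬ k.castSucc < a.castSucc := by rw [Fin.lt_def] at *; simp; omega
        simp [h1, h2, h.ne']
    rw [Finset.sum_congr rfl fun k _ => h k, Finset.sum_add_distrib, ← add_assoc, ← ih]
    simp

/-- The cuts `c` of the unit interval split it into intervals whose lengths `μ` are
convex weights with prescribed tails. -/
theorem exists_weights_of_monotone {m : ℕ} (c : Fin m → ℝ) (hc : Monotone c)
    (h0 : ∀ t, 0 ≤ c t) (h1 : ∀ t, c t ≤ 1) :
    ∃ μ : Fin (m + 1) → ℝ, (∀ j, 0 ≤ μ j) ∧ ∑ j, μ j = 1 ∧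
      ∀ t : Fin m, (∑ j, if t.castSucc < j then μ j else 0) = 1 - c t := by
  set C : ℕ → ℝ := fun a => if a = 0 then 0 else if h : a - 1 < m then c ⟨a - 1, h⟩ else 1 with hC
  have hC0 : C 0 = 0 := by simp [hC]
  have hC1 : C (m + 1) = 1 := by simp [hC]
  have hCt : ∀ t : Fin m, C (t + 1) = c t := by intro t; simp [hC]
  have hCm : Monotone C := by
    refine monotone_nat_of_le_succ fun a => ?_
    rcases a with _ | a
    · simp only [hC]
      simp
      split_ifs
      · exact h0 _
      · exact zero_le_one
    · simp only [hC]
      simp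
      split_ifs with h h' h'
      · exact hc (by simp)
      · exact h1 _
      · omega
      · exact le_rfl
  refine ⟨fun j => C (j + 1) - C j, fun j => sub_nonneg.2 (hCm (Nat.le_succ _)), ?_, fun t => ?_⟩
  · rw [Fin.sum_univ_eq_sum_range (fun j => C (j + 1) - C j), Finset.sum_range_sub, hC0, hC1,
      sub_zero]
  · -- Beyond column `t` the weights are the increments of `C` truncated below at `C (t + 1)`.
    have h : ∀ j : Fin (m + 1), (if t.castSucc < j then C (j + 1) - C j else 0) =
        max (C (j + 1)) (C (t + 1)) - max (C j) (C (t + 1)) := by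
      intro j
      split_ifs with hj
      · rw [Fin.lt_def, Fin.val_castSucc] at hj
        rw [max_eq_left (hCm (by omega)), max_eq_left (hCm (by omega))]
      · rw [Fin.lt_def, Fin.val_castSucc] at hj
        rw [max_eq_right (hCm (by omega)), max_eq_right (hCm (by omega)), sub_self]
    rw [Finset.sum_congr rfl fun j _ => h j,
      Fin.sum_univ_eq_sum_range (fun j => max (C (j + 1)) (C (t + 1)) - max (C j) (C (t + 1))),
      Finset.sum_range_sub (fun j => max (C j) (C (t + 1))), hC0, hC1, hCt, max_eq_left (h1 t),
      max_eq_right (h0 t)]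

theorem exists_weights_of_mem_convexHull_range {ι E : Type*} [Fintype ι] [AddCommGroup E]
    [Module ℝ E] {v : ι → E} {x : E} (hx : x ∈ convexHull ℝ (Set.range v)) :
    ∃ w : ι → ℝ, (∀ i, 0 ≤ w i) ∧ ∑ i, w i = 1 ∧ ∑ i, w i • v i = x := by
  classical
  have h : Set.range v =
      Fintype.linearCombination ℝ v '' Set.range fun i => Pi.single i (1 : ℝ) := by
    rw [← Set.range_comp]
    congr 1
    ext i
    simp [Fintype.linearCombination_apply_single]
  rw [h, ← LinearMap.image_convexHull, convexHull_rangle_single_eq_stdSimplex] at hx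
  obtain ⟨w, hw, rfl⟩ := hx
  exact ⟨w, hw.1, hw.2, by rw [Fintype.linearCombination_apply]⟩

theorem sum_smul_mem_convexHull_range {ι E : Type*} [Fintype ι] [AddCommGroup E]
    [Module ℝ E] (v : ι → E) {w : ι → ℝ} (h0 : ∀ i, 0 ≤ w i) (h1 : ∑ i, w i = 1) :
    ∑ i, w i • v i ∈ convexHull ℝ (Set.range v) :=
  (convex_convexHull ℝ _).sum_mem (fun i _ => h0 i) h1
    fun i _ => subset_convexHull ℝ _ (Set.mem_range_self i)

/-- The pieces of the edgewise subdivision cover the simplex. -/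
theorem exists_mem_edgewisePiece {E : Type*} [NormedAddCommGroup E] [InnerProductSpace ℝ E]
    {m n : ℕ} (hn : 0 < n) (σ : Affine.Simplex ℝ E m) {x : E}
    (hx : x ∈ convexHull ℝ (Set.range σ.points)) :
    ∃ r : Fin m → Fin n, x ∈ edgewisePiece σ r := by
  obtain ⟨w, hw0, hw1, hwx⟩ := exists_weights_of_mem_convexHull_range hx
  have hnpos : (0 : ℝ) < n := Nat.cast_pos.2 hn
  set δ : Fin m → E := fun k => σ.points k.succ - σ.points k.castSucc with hδ
  have habel : ∀ a, σ.points a = σ.points 0 + ∑ k : Fin m, if k.castSucc < a then δ k else 0 :=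
    Fin.eq_zero_add_sum_ite_sub σ.points
  -- `x` is the mean of the step function on `[0, n]` that passes from the vertex `k` to the vertex
  -- `k + 1` at the breakpoint `b k = n * (1 - g k)`.
  set g : Fin m → ℝ := fun k => ∑ a, if k.castSucc < a then w a else 0 with hg
  have hg0 : ∀ k, 0 ≤ g k := fun k => Finset.sum_nonneg fun a _ => by
    split_ifs
    exacts [hw0 a, le_rfl]
  have hg1 : ∀ k, g k ≤ 1 := fun k => by
    rw [← hw1]
    refine Finset.sum_le_sum fun a _ => ?_
    split_ifs
    exacts [le_rfl, hw0 a]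
  have hganti : Antitone g := fun k l hkl => Finset.sum_le_sum fun a _ => by
    split_ifs with h h'
    · exact le_rfl
    · exact absurd (lt_of_le_of_lt (Fin.castSucc_le_castSucc_iff.2 hkl) h) h'
    · exact hw0 a
    · exact le_rfl
  have hxg : x = σ.points 0 + ∑ k, g k • δ k := by
    rw [← hwx, Finset.sum_congr rfl fun a _ => by rw [habel a]]
    simp only [smul_add, Finset.sum_add_distrib]
    rw [← Finset.sum_smul, hw1, one_smul]
    simp only [Finset.smul_sum, hg, Finset.sum_smul]
    rw [Finset.sum_comm]
    simp only [smul_ite, ite_smul, smul_zero, zero_smul]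
  set b : Fin m → ℝ := fun k => n * (1 - g k) with hb
  have hbmono : Monotone b := fun k l hkl =>
    mul_le_mul_of_nonneg_left (sub_le_sub_left (hganti hkl) _) hnpos.le
  have hb0 : ∀ k, 0 ≤ b k := fun k => mul_nonneg hnpos.le (sub_nonneg.2 (hg1 k))
  have hbn : ∀ k, b k ≤ n := fun k => by nlinarith [hg0 k]
  -- Cut `[0, n]` into rows of length one; a breakpoint at `n` is counted in the last row.
  have hrow : ∀ k, ∃ R : Fin n, (R : ℝ) ≤ b k ∧ b k ≤ R + 1 := by
    intro k
    rcases (hbn k).lt_or_eq with h | h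
    · exact ⟨⟨⌊b k⌋₊, (Nat.floor_lt (hb0 k)).2 h⟩, Nat.floor_le (hb0 k),
        (Nat.lt_floor_add_one _).le⟩
    · refine ⟨⟨n - 1, by omega⟩, ?_, ?_⟩
      · rw [h]; exact_mod_cast Nat.sub_le n 1
      · rw [h]
        simp only
        rw [Nat.cast_pred hn]
        linarith
  choose R hR0 hR1 using hrow
  set τ := Tuple.sort fun k => b k - R k with hτ
  have hcmono : Monotone fun t => b (τ t) - R (τ t) := Tuple.monotone_sort fun k => b k - R k
  obtain ⟨μ, hμ0, hμ1, hμt⟩ := exists_weights_of_monotone (fun t => b (τ t) - R (τ t)) hcmono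
    (fun t => sub_nonneg.2 (hR0 _)) (fun t => by linarith [hR1 (τ t)])
  refine ⟨fun t => R (τ t), ?_⟩
  obtain ⟨π, hπ, hcol⟩ := exists_perm_lt_edgewiseColor fun t => R (τ t)
  -- Both orders sort the breakpoints, so they list the same values.
  have hbπ : ∀ k, b (τ (π k)) = b k := by
    have h1 : Monotone (b ∘ (π.trans τ)) := by
      intro k l hkl
      simp only [Function.comp, Equiv.trans_apply]
      rcases hπ k l hkl with h | ⟨h, h'⟩
      · have : ((R (τ (π k)) : ℕ) : ℝ) + 1 ≤ (R (τ (π l)) : ℕ) := by exact_mod_cast h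
        linarith [hR1 (τ (π k)), hR0 (τ (π l))]
      · have := hcmono h'
        simp only [h] at this
        linarith
    have h2 : Monotone (b ∘ (Equiv.refl (Fin m))) := hbmono
    exact fun k => congrFun (Tuple.unique_monotone h1 h2) k
  have hcoef : ∀ k, (∑ i, ∑ j, if k.castSucc < edgewiseColor (fun t => R (τ t)) i j
      then μ j else 0) = n * g k := by
    intro k
    have hi : ∀ i, (∑ j, if k.castSucc < edgewiseColor (fun t => R (τ t)) i j then μ j else 0) =
        (if R (τ (π k)) < i then 1 else 0) +
          if R (τ (π k)) = i then 1 - (b k - R (τ (π k))) else 0 := by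
      intro i
      simp only [hcol]
      rcases lt_trichotomy (R (τ (π k))) i with h | h | h
      · simp [h, h.ne, hμ1]
      · simp only [h, lt_irrefl, false_or, true_and, if_false, if_true, zero_add]
        rw [hμt (π k), hbπ, h]
      · simp [h.ne', h.not_gt]
    rw [Finset.sum_congr rfl fun i _ => hi i, Finset.sum_add_distrib, Finset.sum_boole,
      Finset.sum_ite_eq, if_pos (Finset.mem_univ _)]
    have hcard : (Finset.univ.filter fun i => R (τ (π k)) < i) = Finset.Ioi (R (τ (π k))) := by
      ext; simp
    rw [hcard, Fin.card_Ioi, Nat.sub_sub, Nat.cast_sub (by have := (R (τ (π k))).2; omega)]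
    simp only [hb]
    push_cast
    ring
  have hsum : x = ∑ j, μ j • edgewiseVertex σ (fun t => R (τ t)) j := by
    have hv : ∀ j, edgewiseVertex σ (fun t => R (τ t)) j = σ.points 0 +
        (1 / (n : ℝ)) • ∑ k, ∑ i, if k.castSucc < edgewiseColor (fun t => R (τ t)) i j
          then δ k else 0 := by
      intro j
      rw [edgewiseVertex, Finset.sum_congr rfl fun i _ => habel _, Finset.sum_add_distrib,
        Finset.sum_comm, smul_add]
      congr 1
      rw [Finset.sum_const, Finset.card_univ, Fintype.card_fin, ← Nat.cast_smul_eq_nsmul ℝ,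
        smul_smul, one_div_mul_cancel hnpos.ne', one_smul]
    simp only [hxg, hv, smul_add, Finset.sum_add_distrib]
    rw [← Finset.sum_smul, hμ1, one_smul]
    congr 1
    simp only [smul_comm (μ _) (1 / (n : ℝ))]
    rw [← Finset.smul_sum]
    simp only [Finset.smul_sum (r := μ _)]
    rw [Finset.sum_comm, Finset.smul_sum]
    refine Finset.sum_congr rfl fun k _ => ?_
    have : g k = (1 / (n : ℝ)) * (n * g k) := by field_simp
    rw [this, ← hcoef k, mul_smul, Finset.sum_smul, Finset.sum_comm]
    simp only [Finset.sum_smul, smul_ite, ite_smul, smul_zero, zero_smul]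
  rw [hsum]
  exact sum_smul_mem_convexHull_range _ hμ0 hμ1

/-! ### Position and diameter of the pieces -/

theorem edgewiseVertex_mem_convexHull {E : Type*} [NormedAddCommGroup E] [InnerProductSpace ℝ E]
    {m n : ℕ} (hn : 0 < n) (σ : Affine.Simplex ℝ E m) (r : Fin m → Fin n) (j : Fin (m + 1)) :
    edgewiseVertex σ r j ∈ convexHull ℝ (Set.range σ.points) := by
  rw [edgewiseVertex, Finset.smul_sum]
  refine (convex_convexHull ℝ _).sum_mem (fun i _ => by positivity) ?_
    fun i _ => subset_convexHull ℝ _ (Set.mem_range_self _)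
  rw [Finset.sum_const, Finset.card_univ, Fintype.card_fin, nsmul_eq_mul]
  have : (n : ℝ) ≠ 0 := by positivity
  field_simp

theorem isBounded_edgewisePiece {E : Type*} [NormedAddCommGroup E] [InnerProductSpace ℝ E]
    {m n : ℕ} (σ : Affine.Simplex ℝ E m) (r : Fin m → Fin n) :
    Bornology.IsBounded (edgewisePiece σ r) :=
  isBounded_convexHull.2 (Set.finite_range _).isBounded

theorem dist_edgewiseVertex_le_diam {E : Type*} [NormedAddCommGroup E] [InnerProductSpace ℝ E]
    {m n : ℕ} (σ : Affine.Simplex ℝ E m) (r : Fin m → Fin n) (i j : Fin (m + 1)) :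
    dist (edgewiseVertex σ r i) (edgewiseVertex σ r j) ≤ Metric.diam (edgewisePiece σ r) :=
  Metric.dist_le_diam_of_mem (isBounded_edgewisePiece σ r)
    (subset_convexHull ℝ _ (Set.mem_range_self i)) (subset_convexHull ℝ _ (Set.mem_range_self j))

/-- The piece all of whose column steps lie in the first row has positive diameter: its first and
last vertices differ by `1 / n` times an edge of the simplex. -/
theorem diam_edgewisePiece_const_zero_pos {E : Type*} [NormedAddCommGroup E]
    [InnerProductSpace ℝ E] {m n : ℕ} (hm : 0 < m) (σ : Affine.Simplex ℝ E m) :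
    0 < Metric.diam (edgewisePiece σ fun _ : Fin m => (0 : Fin (n + 1))) := by
  refine lt_of_lt_of_le (dist_pos.2 ?_)
    (dist_edgewiseVertex_le_diam σ (fun _ => (0 : Fin (n + 1))) 0 (Fin.last m))
  have hc0 : edgewiseColor (fun _ : Fin m => (0 : Fin (n + 1))) 0 0 = 0 := by
    simp [edgewiseColor]
  have hcl : edgewiseColor (fun _ : Fin m => (0 : Fin (n + 1))) 0 (Fin.last m) = Fin.last m := by
    ext
    simp [edgewiseColor, Fin.castSucc_lt_last]
  have hcs : ∀ (i : Fin n) j, edgewiseColor (fun _ : Fin m => (0 : Fin (n + 1))) i.succ j =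
      Fin.last m := by
    intro i j
    ext
    simp [edgewiseColor]
  intro h
  rw [edgewiseVertex, edgewiseVertex] at h
  have h' := smul_right_injective E
    (r := 1 / (((n + 1 : ℕ) : ℝ))) (by positivity) h
  rw [Fin.sum_univ_succ, Fin.sum_univ_succ, hc0, hcl] at h'
  simp only [hcs, add_left_inj] at h'
  have := congrArg Fin.val (σ.independent.injective h')
  simp at this
  omega

/-! ### Facets of a polytope around the origin -/

open scoped RealInnerProductSpace in
/-- Every ray from the origin meets a facet of a polytope that has the origin in its interior. The
outer normal of that facet is a vertex of the polar polytope at which the direction of the ray is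
maximal: at a vertex of the polar, the tight constraints span the space. -/
theorem exists_isFacet_smul_mem {E : Type*} [NormedAddCommGroup E] [InnerProductSpace ℝ E]
    [FiniteDimensional ℝ E] {X : Set E} (hX : X.Finite) {a : ℝ} (ha : 0 < a)
    (hball : Metric.closedBall (0 : E) a ⊆ convexHull ℝ X) {u : E} (hu : u ≠ 0) :
    ∃ F, IsFacet (convexHull ℝ X) F ∧ ∃ t : ℝ, 0 < t ∧ t • u ∈ F := by
  set Q : Set E := {l | ∀ x ∈ X, ⟪l, x⟫ ≤ 1} with hQ
  have hQP : ∀ l ∈ Q, ∀ x ∈ convexHull ℝ X, ⟪l, x⟫ ≤ 1 := fun l hl x hx =>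
    convexHull_min (t := {x | ⟪l, x⟫ ≤ 1}) hl
      (convex_halfSpace_le (innerSL ℝ l).isLinear 1) hx
  have h0P : (0 : E) ∈ convexHull ℝ X := hball (Metric.mem_closedBall_self ha.le)
  have hQbdd : ∀ l ∈ Q, ‖l‖ ≤ 1 / a := by
    intro l hl
    rcases eq_or_ne l 0 with rfl | hl0
    · rw [norm_zero]; positivity
    · have hlpos := norm_pos_iff.2 hl0
      have hmem : (a / ‖l‖) • l ∈ Metric.closedBall (0 : E) a := by
        rw [mem_closedBall_zero_iff, norm_smul, Real.norm_of_nonneg (by positivity),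
          div_mul_cancel₀ _ hlpos.ne']
      have := hQP l hl _ (hball hmem)
      rw [real_inner_smul_right, real_inner_self_eq_norm_sq] at this
      rw [le_div_iff₀ ha]
      calc ‖l‖ * a = a / ‖l‖ * ‖l‖ ^ 2 := by field_simp
        _ ≤ 1 := this
  have hQcl : IsClosed Q := by
    have : Q = ⋂ x ∈ X, {l | ⟪l, x⟫ ≤ 1} := by ext; simp [hQ]
    rw [this]
    exact isClosed_biInter fun x _ => isClosed_le (by fun_prop) continuous_const
  have hQc : IsCompact Q := Metric.isCompact_of_isClosed_isBounded hQcl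
    (isBounded_iff_forall_norm_le.2 ⟨1 / a, hQbdd⟩)
  have h0Q : (0 : E) ∈ Q := fun x _ => by simp
  have hexp : IsExposed ℝ Q ((innerSL ℝ u).toExposed Q) :=
    ContinuousLinearMap.toExposed.isExposed
  obtain ⟨l₀, hl₀Q, hl₀⟩ := hQc.exists_isMaxOn ⟨0, h0Q⟩ (innerSL ℝ u).continuous.continuousOn
  obtain ⟨l, hl⟩ := (hexp.isCompact hQc).extremePoints_nonempty ⟨l₀, hl₀Q, fun y hy => hl₀ hy⟩
  have hlext : l ∈ Q.extremePoints ℝ := hexp.isExtreme.extremePoints_subset_extremePoints hl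
  have hlQ : l ∈ Q := hlext.1
  have hmax : ∀ l' ∈ Q, ⟪l', u⟫ ≤ ⟪l, u⟫ := fun l' hl' => by
    have := hl.1.2 l' hl'
    rwa [innerSL_apply_apply, innerSL_apply_apply, real_inner_comm, real_inner_comm l u] at this
  have hM : 0 < ⟪l, u⟫ := by
    obtain ⟨C, hC, hXC⟩ := hX.isBounded.exists_pos_norm_le
    have hupos := norm_pos_iff.2 hu
    have hmem : (1 / (C * ‖u‖)) • u ∈ Q := fun x hx => by
      rw [real_inner_smul_left, one_div, inv_mul_le_iff₀ (by positivity), mul_one]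
      calc ⟪u, x⟫ ≤ ‖u‖ * ‖x‖ := real_inner_le_norm u x
        _ ≤ C * ‖u‖ := by rw [mul_comm]; gcongr; exact hXC x hx
    refine lt_of_lt_of_le ?_ (hmax _ hmem)
    rw [real_inner_smul_left, real_inner_self_eq_norm_sq]
    positivity
  have hpP : (1 / ⟪l, u⟫) • u ∈ convexHull ℝ X := by
    by_contra hp
    obtain ⟨f, s, hfs, hsf⟩ := geometric_hahn_banach_closed_point (convex_convexHull ℝ X)
      (hX.isClosed_convexHull ℝ) hp
    have hs : 0 < s := by simpa using hfs 0 h0P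
    set v := (InnerProductSpace.toDual ℝ E).symm f with hv
    have hfv : ∀ y, f y = ⟪v, y⟫ := fun y => by rw [hv, InnerProductSpace.toDual_symm_apply]
    have hvQ : (1 / s) • v ∈ Q := fun x hx => by
      rw [real_inner_smul_left, one_div, inv_mul_le_iff₀ hs, mul_one, ← hfv]
      exact (hfs x (subset_convexHull ℝ X hx)).le
    have h1 := hmax _ hvQ
    rw [real_inner_smul_left, one_div, inv_mul_le_iff₀ hs] at h1
    rw [hfv, real_inner_smul_right, one_div, lt_inv_mul_iff₀ hM] at hsf
    linarith
  have hpl : ⟪l, (1 / ⟪l, u⟫) • u⟫ = 1 := by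
    rw [real_inner_smul_right, one_div_mul_cancel hM.ne']
  set p := (1 / ⟪l, u⟫) • u with hp
  set F : Set E := {x ∈ convexHull ℝ X | ⟪l, x⟫ = 1} with hF
  have hpF : p ∈ F := ⟨hpP, hpl⟩
  have hspan : Submodule.span ℝ F = ⊤ := by
    rw [← Submodule.orthogonal_eq_bot_iff, Submodule.eq_bot_iff]
    intro v hv
    have hvF : ∀ x ∈ F, ⟪v, x⟫ = 0 := fun x hx =>
      (Submodule.mem_orthogonal' _ _).1 hv x (Submodule.subset_span hx)
    -- A vector orthogonal to all tight constraints is a direction in which `l` could be moved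
    -- both ways inside the polar.
    have hev : ∀ᶠ t : ℝ in nhds 0, ∀ x ∈ X, ⟪l + t • v, x⟫ ≤ 1 ∧ ⟪l - t • v, x⟫ ≤ 1 := by
      rw [Filter.eventually_all_finite hX]
      intro x hx
      rcases (hlQ x hx).lt_or_eq with h | h
      · have h1 : Filter.Tendsto (fun t : ℝ => ⟪l + t • v, x⟫) (nhds 0) (nhds ⟪l, x⟫) := by
          have : Continuous fun t : ℝ => ⟪l + t • v, x⟫ := by fun_prop
          simpa using this.tendsto 0
        have h2 : Filter.Tendsto (fun t : ℝ => ⟪l - t • v, x⟫) (nhds 0) (nhds ⟪l, x⟫) := by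
          have : Continuous fun t : ℝ => ⟪l - t • v, x⟫ := by fun_prop
          simpa using this.tendsto 0
        filter_upwards [h1.eventually_lt_const h, h2.eventually_lt_const h] with t ht ht'
        exact ⟨ht.le, ht'.le⟩
      · refine Filter.Eventually.of_forall fun t => ?_
        have := hvF x ⟨subset_convexHull ℝ X hx, h⟩
        rw [inner_add_left, inner_sub_left, real_inner_smul_left, this, h]
        simp
    obtain ⟨t, ht, htpos⟩ :=
      ((hev.filter_mono nhdsWithin_le_nhds).and (self_mem_nhdsWithin (s := Set.Ioi (0 : ℝ)))).exists
    have hseg : l ∈ openSegment ℝ (l + t • v) (l - t • v) := by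
      refine ⟨1 / 2, 1 / 2, by norm_num, by norm_num, by norm_num, ?_⟩
      module
    have := hlext.2 (fun x hx => (ht x hx).1) (fun x hx => (ht x hx).2) hseg
    rw [add_eq_left, smul_eq_zero] at this
    exact this.resolve_left (ne_of_gt htpos)
  have hexpF : IsExposed ℝ (convexHull ℝ X) F := by
    refine fun _ => ⟨innerSL ℝ l, ?_⟩
    ext x
    simp only [hF, innerSL_apply_apply, Set.mem_ofPred_eq]
    refine and_congr_right fun hx => ⟨fun h y hy => h ▸ hQP l hlQ y hy, fun h => ?_⟩
    exact le_antisymm (hQP l hlQ x hx) (hpl ▸ h p hpP)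
  have htop : vectorSpan ℝ (convexHull ℝ X) = ⊤ := by
    rw [← direction_affineSpan, ((convex_convexHull ℝ X).interior_nonempty_iff_affineSpan_eq_top).1
      ⟨0, mem_interior.2 ⟨_, Metric.ball_subset_closedBall.trans hball, Metric.isOpen_ball,
        Metric.mem_ball_self ha⟩⟩, AffineSubspace.direction_top]
  have hl0 : l ≠ 0 := by
    rintro rfl
    simp at hM
  have hle : vectorSpan ℝ F ≤ (ℝ ∙ l)ᗮ := by
    rw [vectorSpan_def, Submodule.span_le]
    rintro _ ⟨x, hx, y, hy, rfl⟩
    rw [SetLike.mem_coe, Submodule.mem_orthogonal_singleton_iff_inner_right]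
    change ⟪l, x - y⟫ = 0
    rw [inner_sub_right, hx.2, hy.2, sub_self]
  have hge : (⊤ : Submodule ℝ E) ≤ vectorSpan ℝ F ⊔ ℝ ∙ p := by
    rw [← hspan, Submodule.span_le]
    intro x hx
    have : x = (x -ᵥ p) + p := by simp
    rw [this]
    exact Submodule.add_mem_sup (vsub_mem_vectorSpan ℝ hx hpF)
      (Submodule.mem_span_singleton_self p)
  refine ⟨F, ⟨hexpF, ⟨p, hpF⟩, ?_⟩, 1 / ⟪l, u⟫, by positivity, hpF⟩
  rw [htop, finrank_top]
  apply le_antisymm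
  · have h1 := Submodule.finrank_mono hle
    have h2 := Submodule.finrank_add_finrank_orthogonal (ℝ ∙ l)
    rw [finrank_span_singleton hl0] at h2
    omega
  · have h1 := Submodule.finrank_mono hge
    have h2 := Submodule.finrank_add_le_finrank_add_finrank (vectorSpan ℝ F) (ℝ ∙ p)
    have h3 := finrank_span_le_card (R := ℝ) ({p} : Set E)
    rw [finrank_top] at h1
    simp at h3
    omega

open scoped RealInnerProductSpace in
theorem IsFacet.le_norm {E : Type*} [NormedAddCommGroup E] [InnerProductSpace ℝ E]
    [FiniteDimensional ℝ E] {P F : Set E} (hF : IsFacet P F) {a : ℝ} (ha : 0 < a)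
    (hball : Metric.closedBall (0 : E) a ⊆ P) {y : E} (hy : y ∈ F) : a ≤ ‖y‖ := by
  obtain ⟨f, hf⟩ := hF.isExposed hF.nonempty
  set v := (InnerProductSpace.toDual ℝ E).symm f with hv
  have hfv : ∀ y, f y = ⟪v, y⟫ := fun y => by rw [hv, InnerProductSpace.toDual_symm_apply]
  have hv0 : v ≠ 0 := by
    intro h
    have hFP : F = P := by
      rw [hf]
      ext x
      simp [hfv, h]
    have := hF.finrank_add_one
    rw [hFP] at this
    omega
  have hvpos := norm_pos_iff.2 hv0
  have hmem : (a / ‖v‖) • v ∈ Metric.closedBall (0 : E) a := by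
    rw [mem_closedBall_zero_iff, norm_smul, Real.norm_of_nonneg (by positivity),
      div_mul_cancel₀ _ hvpos.ne']
  rw [hf] at hy
  have h := hy.2 _ (hball hmem)
  rw [hfv, hfv, real_inner_smul_right, real_inner_self_eq_norm_sq] at h
  have h2 := h.trans (real_inner_le_norm v y)
  have h3 : a / ‖v‖ * ‖v‖ ^ 2 = ‖v‖ * a := by field_simp
  rw [h3] at h2
  exact le_of_mul_le_mul_left h2 hvpos

/-! ### Radial projection of convex combinations -/

open scoped RealInnerProductSpace in
/-- The variance of a convex combination, by the sum over pairs. -/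
theorem sum_mul_norm_sq_sub_norm_sum_sq {ι E : Type*} [Fintype ι] [NormedAddCommGroup E]
    [InnerProductSpace ℝ E] {μ : ι → ℝ} (h1 : ∑ i, μ i = 1) (w : ι → E) :
    ∑ i, μ i * ‖w i‖ ^ 2 - ‖∑ i, μ i • w i‖ ^ 2 =
      1 / 2 * ∑ i, ∑ j, μ i * μ j * ‖w i - w j‖ ^ 2 := by
  have hy : ‖∑ i, μ i • w i‖ ^ 2 = ∑ i, ∑ j, μ i * μ j * ⟪w i, w j⟫ := by
    rw [← real_inner_self_eq_norm_sq, sum_inner]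
    refine Finset.sum_congr rfl fun i _ => ?_
    rw [inner_sum]
    refine Finset.sum_congr rfl fun j _ => ?_
    rw [real_inner_smul_left, real_inner_smul_right, mul_assoc]
  have hA : ∑ i, ∑ j, μ i * μ j * ‖w i‖ ^ 2 = ∑ i, μ i * ‖w i‖ ^ 2 := by
    refine Finset.sum_congr rfl fun i _ => ?_
    rw [← Finset.sum_mul, ← Finset.mul_sum, h1, mul_one]
  have hB : ∑ i, ∑ j, μ i * μ j * ‖w j‖ ^ 2 = ∑ i, μ i * ‖w i‖ ^ 2 := by
    rw [Finset.sum_comm, ← hA]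
    simp only [mul_comm (μ _) (μ _)]
  have hC : ∑ i, ∑ j, μ i * μ j * ‖w i - w j‖ ^ 2 = ∑ i, ∑ j, μ i * μ j * ‖w i‖ ^ 2 -
      2 * ∑ i, ∑ j, μ i * μ j * ⟪w i, w j⟫ + ∑ i, ∑ j, μ i * μ j * ‖w j‖ ^ 2 := by
    simp only [Finset.mul_sum, ← Finset.sum_sub_distrib, ← Finset.sum_add_distrib]
    refine Finset.sum_congr rfl fun i _ => Finset.sum_congr rfl fun j _ => ?_
    rw [norm_sub_sq_real]
    ring
  rw [hC, hA, hB, hy]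
  ring

/-- The variance of points with mutual distances at most `D` is largest when all weights are
equal. -/
theorem sq_sum_mul_norm_le {ι E : Type*} [Fintype ι] [NormedAddCommGroup E]
    [InnerProductSpace ℝ E] {μ : ι → ℝ} (h0 : ∀ i, 0 ≤ μ i) (h1 : ∑ i, μ i = 1) (w : ι → E)
    {D : ℝ} (hD : ∀ i j, dist (w i) (w j) ≤ D) :
    (∑ i, μ i * ‖w i‖) ^ 2 ≤ ‖∑ i, μ i • w i‖ ^ 2 +
      ((Fintype.card ι : ℝ) - 1) / (2 * (Fintype.card ι : ℝ)) * D ^ 2 := by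
  classical
  have hjensen : (∑ i, μ i * ‖w i‖) ^ 2 ≤ ∑ i, μ i * ‖w i‖ ^ 2 := by
    simpa using (even_two.convexOn_pow (𝕜 := ℝ)).map_sum_le (t := Finset.univ)
      (p := fun i => ‖w i‖) (fun i _ => h0 i) h1 fun i _ => Set.mem_univ _
  have hvar := sum_mul_norm_sq_sub_norm_sum_sq h1 w
  have hpair : ∑ i, ∑ j, μ i * μ j * ‖w i - w j‖ ^ 2 ≤ D ^ 2 * (1 - ∑ i, μ i ^ 2) := by
    have h : ∑ i, ∑ j, μ i * μ j * ‖w i - w j‖ ^ 2 ≤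
        ∑ i, ∑ j, (D ^ 2 * (μ i * μ j) - if i = j then D ^ 2 * (μ i * μ j) else 0) := by
      refine Finset.sum_le_sum fun i _ => Finset.sum_le_sum fun j _ => ?_
      split_ifs with hij
      · simp [hij]
      · rw [sub_zero, mul_comm (D ^ 2)]
        refine mul_le_mul_of_nonneg_left ?_ (mul_nonneg (h0 i) (h0 j))
        rw [← dist_eq_norm]
        exact pow_le_pow_left₀ dist_nonneg (hD i j) 2
    refine h.trans_eq ?_
    simp only [Finset.sum_sub_distrib, Finset.sum_ite_eq, Finset.mem_univ, if_true,
      ← Finset.mul_sum, h1, mul_one, mul_sub, sq]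
  have hcs : 1 ≤ (Fintype.card ι : ℝ) * ∑ i, μ i ^ 2 := by
    have := sq_sum_le_card_mul_sum_sq (s := Finset.univ) (f := μ)
    rwa [h1, one_pow, Finset.card_univ] at this
  have hk : (0 : ℝ) < Fintype.card ι := by
    rcases (Nat.cast_nonneg (α := ℝ) (Fintype.card ι)).lt_or_eq with h | h
    · exact h
    · rw [← h, zero_mul] at hcs
      linarith
  have hsq : 1 - ∑ i, μ i ^ 2 ≤ ((Fintype.card ι : ℝ) - 1) / Fintype.card ι := by
    rw [le_div_iff₀ hk]
    linarith
  have h2 : D ^ 2 * (1 - ∑ i, μ i ^ 2) ≤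
      D ^ 2 * (((Fintype.card ι : ℝ) - 1) / Fintype.card ι) :=
    mul_le_mul_of_nonneg_left hsq (sq_nonneg D)
  have h3 : ((Fintype.card ι : ℝ) - 1) / (2 * (Fintype.card ι : ℝ)) * D ^ 2 =
      1 / 2 * (D ^ 2 * (((Fintype.card ι : ℝ) - 1) / Fintype.card ι)) := by
    field_simp
  rw [h3]
  linarith

/-- Radial projection of the points moves the point of a convex combination along its ray: it
stays in the convex hull after division by the mean norm. -/
theorem inv_sum_mul_norm_smul_mem_convexHull {ι E : Type*} [Fintype ι] [NormedAddCommGroup E]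
    [NormedSpace ℝ E] {μ : ι → ℝ} (h0 : ∀ i, 0 ≤ μ i) {w : ι → E} (hw : ∀ i, w i ≠ 0)
    (hN : 0 < ∑ i, μ i * ‖w i‖) :
    (∑ i, μ i * ‖w i‖)⁻¹ • ∑ i, μ i • w i ∈
      convexHull ℝ (Set.range fun i => (1 / ‖w i‖) • w i) := by
  set N := ∑ i, μ i * ‖w i‖ with hNdef
  have h : N⁻¹ • ∑ i, μ i • w i = ∑ i, (N⁻¹ * (μ i * ‖w i‖)) • ((1 / ‖w i‖) • w i) := by
    rw [Finset.smul_sum]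
    refine Finset.sum_congr rfl fun i _ => ?_
    have := norm_ne_zero_iff.2 (hw i)
    rw [smul_smul, smul_smul]
    congr 1
    field_simp
  rw [h]
  refine sum_smul_mem_convexHull_range _ (fun i => ?_) ?_
  · have := h0 i
    positivity
  · rw [← Finset.mul_sum, ← hNdef, inv_mul_cancel₀ hN.ne']

theorem Convex.smul_closedBall_subset {E : Type*} [NormedAddCommGroup E] [NormedSpace ℝ E]
    [Nontrivial E] {C : Set E} (hC : Convex ℝ C) {a : ℝ} (ha : 0 < a)
    (h : ∀ u : E, ‖u‖ = 1 → ∃ s, a ≤ s ∧ s • u ∈ C) :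
    (fun x : E => a • x) '' Metric.closedBall 0 1 ⊆ C := by
  have h0 : (0 : E) ∈ C := by
    obtain ⟨u, hu⟩ := exists_norm_eq E zero_le_one
    obtain ⟨s, hs, hsC⟩ := h u hu
    obtain ⟨t, ht, htC⟩ := h (-u) (by rw [norm_neg, hu])
    have hst : 0 < s + t := by linarith
    have := hC hsC htC (a := t / (s + t)) (b := s / (s + t)) (div_nonneg (by linarith) hst.le)
      (div_nonneg (by linarith) hst.le) (by field_simp; ring)
    have he : (t / (s + t)) • s • u + (s / (s + t)) • t • -u = 0 := by
      rw [smul_neg, smul_neg, smul_smul, smul_smul, ← sub_eq_add_neg, ← sub_smul]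
      rw [show t / (s + t) * s - s / (s + t) * t = 0 by ring, zero_smul]
    rwa [he] at this
  rintro _ ⟨y, hy, rfl⟩
  rw [mem_closedBall_zero_iff] at hy
  rcases eq_or_ne y 0 with rfl | hy0
  · simpa using h0
  · have hypos := norm_pos_iff.2 hy0
    obtain ⟨s, hs, hsC⟩ := h ((‖y‖)⁻¹ • y) (norm_smul_inv_norm hy0)
    have hspos : 0 < s := ha.trans_le hs
    have hle : a * ‖y‖ / s ≤ 1 := by
      rw [div_le_one hspos]
      nlinarith
    have := hC.smul_mem_of_zero_mem h0 hsC (t := a * ‖y‖ / s) ⟨by positivity, hle⟩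
    rw [smul_smul, smul_smul] at this
    rwa [show a * ‖y‖ / s * s * ‖y‖⁻¹ = a by field_simp] at this

/-! ### Refined approximations of the ball -/

theorem Geometry.SimplicialComplex.exists_facet_superset {E : Type*} [AddCommGroup E] [Module ℝ E]
    {K : Geometry.SimplicialComplex ℝ E} (hK : K.faces.Finite) {s : Finset E} (hs : s ∈ K.faces) :
    ∃ t ∈ K.facets, s ⊆ t := by
  obtain ⟨t, hst, ht⟩ := hK.exists_le_maximal hs
  exact ⟨t, ⟨ht.prop, fun t' ht' htt' => le_antisymm htt' (ht.le_of_ge ht' htt')⟩, hst⟩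

theorem mainTheorem5 {E : Type*} [NormedAddCommGroup E] [InnerProductSpace ℝ E]
    [FiniteDimensional ℝ E] (d : ℕ) (hd : 2 ≤ d) (hE : Module.finrank ℝ E = d)
    (X : Set E) (ε : ℝ) (hX : IsInnerApproximation (Metric.closedBall (0 : E) 1) X ε)
    (K : Geometry.SimplicialComplex ℝ E) (hK : TriangulatesFacets K (convexHull ℝ X))
    -- an ordering of the vertices of every maximal simplex of the triangulation
    (σ : K.facets → Affine.Simplex ℝ E (d - 1))
    (hσ : ∀ s : K.facets, Set.range (σ s).points = ((s : Finset E) : Set E))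
    (hcirc : ∀ s : K.facets, (σ s).circumcenter ∈ convexHull ℝ (Set.range (σ s).points))
    (n : ℕ) (hn : 2 ≤ n) (D : ℝ) (hD : IsGreatest (pieceDiameters σ n) D) :
    ∃ εn : ℝ,
      (1 + εn) ^ 2 = 1 + ((d : ℝ) - 1) / (2 * (d : ℝ)) * D ^ 2 * (1 + ε) ^ 2 ∧
      IsInnerApproximation (Metric.closedBall (0 : E) 1) (projectedVertices σ n) εn := by
  have hnpos : 0 < n := by omega
  have : Nontrivial E := Module.nontrivial_of_finrank_pos (R := ℝ) (by omega)
  have hε := hX.pos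
  have ha : 0 < 1 / (1 + ε) := by positivity
  have hball : Metric.closedBall (0 : E) (1 / (1 + ε)) ⊆ convexHull ℝ X := by
    refine Set.Subset.trans (fun x hx => ?_) hX.subset_convexHull
    rw [mem_closedBall_zero_iff] at hx
    refine ⟨(1 + ε) • x, ?_, ?_⟩
    · rw [mem_closedBall_zero_iff, norm_smul, Real.norm_of_nonneg (by positivity)]
      rwa [le_div_iff₀ (by positivity), mul_comm] at hx
    · simp only
      rw [smul_smul, one_div_mul_cancel (by positivity), one_smul]
  -- The simplices of the triangulation lie on the boundary, outside the inscribed ball.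
  have hnorm : ∀ s, ∀ y ∈ convexHull ℝ (Set.range (σ s).points), 1 / (1 + ε) ≤ ‖y‖ := by
    intro s y hy
    rw [hσ] at hy
    obtain ⟨F, hF, hsF⟩ := hK.subset_facet s s.2.1
    exact hF.le_norm ha hball (hsF hy)
  have hv0 : ∀ s r j, edgewiseVertex (n := n) (σ s) r j ≠ 0 := fun s r j =>
    norm_pos_iff.1 (ha.trans_le (hnorm s _ (edgewiseVertex_mem_convexHull hnpos (σ s) r j)))
  have hcover : ∀ u : E, u ≠ 0 → ∃ (s : K.facets) (t : ℝ), 0 < t ∧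
      t • u ∈ convexHull ℝ (Set.range (σ s).points) := by
    intro u hu
    obtain ⟨F, hF, t, ht, htF⟩ := exists_isFacet_smul_mem hX.finite ha hball hu
    obtain ⟨s, hs, -, hus⟩ := hK.cover F hF _ htF
    obtain ⟨s', hs', hss'⟩ := Geometry.SimplicialComplex.exists_facet_superset hK.finite hs
    refine ⟨⟨s', hs'⟩, t, ht, ?_⟩
    rw [hσ]
    exact convexHull_mono (Finset.coe_subset.2 hss') hus
  have hdiam : ∀ s r, Metric.diam (edgewisePiece (n := n) (σ s) r) ≤ D :=
    fun s r => hD.2 ⟨s, r, rfl⟩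
  have hDpos : 0 < D := by
    obtain ⟨u, hu⟩ := exists_ne (0 : E)
    obtain ⟨s, -⟩ := hcover u hu
    obtain ⟨k, rfl⟩ := Nat.exists_eq_add_of_lt hnpos
    rw [zero_add] at hdiam
    exact (diam_edgewisePiece_const_zero_pos (by omega) (σ s)).trans_le (hdiam s _)
  have hd' : (2 : ℝ) ≤ d := by exact_mod_cast hd
  set κ : ℝ := ((d : ℝ) - 1) / (2 * (d : ℝ)) with hκ
  have hκpos : 0 < κ := div_pos (by linarith) (by linarith)
  set A : ℝ := 1 + κ * D ^ 2 * (1 + ε) ^ 2 with hA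
  have hA1 : 1 < A := by
    have : 0 < κ * D ^ 2 * (1 + ε) ^ 2 := by positivity
    linarith
  have hsqrt : 1 < √A := Real.lt_sqrt_of_sq_lt (by simpa using hA1)
  have hpos : 0 < √A - 1 := by linarith
  have hsub : (fun x : E => (1 / (1 + (√A - 1))) • x) '' Metric.closedBall 0 1 ⊆
      convexHull ℝ (projectedVertices σ n) := by
    rw [add_sub_cancel]
    refine (convex_convexHull ℝ _).smul_closedBall_subset (by positivity) fun u hu => ?_
    obtain ⟨s, t, ht, htu⟩ := hcover u (norm_ne_zero_iff.1 (by rw [hu]; exact one_ne_zero))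
    obtain ⟨r, hr⟩ := exists_mem_edgewisePiece hnpos (σ s) htu
    obtain ⟨μ, hμ0, hμ1, hμ⟩ := exists_weights_of_mem_convexHull_range hr
    have hnt : ‖t • u‖ = t := by rw [norm_smul, hu, mul_one, Real.norm_of_nonneg ht.le]
    have hat : 1 / (1 + ε) ≤ t := hnt ▸ hnorm s _ htu
    set w := edgewiseVertex (σ s) r with hw
    set N := ∑ j, μ j * ‖w j‖ with hN
    have hN2 : N ^ 2 ≤ t ^ 2 + κ * D ^ 2 := by
      have h := sq_sum_mul_norm_le hμ0 hμ1 w (D := D)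
        fun i j => (dist_edgewiseVertex_le_diam (σ s) r i j).trans (hdiam s r)
      have hcard : ((d - 1 + 1 : ℕ) : ℝ) = d := by rw [Nat.sub_add_cancel (by omega)]
      rwa [hμ, hnt, Fintype.card_fin, hcard] at h
    have hNpos : 0 < N := by
      have h : t ≤ N := by
        rw [← hnt, ← hμ]
        refine (norm_sum_le _ _).trans_eq (Finset.sum_congr rfl fun j _ => ?_)
        rw [norm_smul, Real.norm_of_nonneg (hμ0 j)]
      exact ht.trans_le h
    -- The point `t • u` of the piece is carried to `(N⁻¹ * t) • u` by the projection.
    refine ⟨N⁻¹ * t, ?_, ?_⟩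
    · have h1 : 1 ≤ t * (1 + ε) := (div_le_iff₀ (by positivity)).1 hat
      have h2 : N ^ 2 ≤ (t * √A) ^ 2 := by
        have h3 : κ * D ^ 2 * 1 ^ 2 ≤ κ * D ^ 2 * (t * (1 + ε)) ^ 2 := by gcongr
        rw [mul_pow, Real.sq_sqrt (by linarith), hA]
        linarith
      have h4 : N ≤ t * √A := le_of_sq_le_sq h2 (by positivity)
      rw [inv_mul_eq_div, div_le_div_iff₀ (by positivity) hNpos, one_mul]
      exact h4
    · rw [← smul_smul, ← hμ]
      refine convexHull_mono ?_
        (inv_sum_mul_norm_smul_mem_convexHull hμ0 (fun j => hv0 s r j) hNpos)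
      rintro _ ⟨j, rfl⟩
      exact ⟨s, r, j, rfl⟩
  refine ⟨√A - 1, by rw [add_sub_cancel, Real.sq_sqrt (by linarith)], ?_, ?_, ?_, hpos, hsub⟩
  · have : Finite K.facets := (hK.finite.subset fun s hs => hs.1).to_subtype
    refine (Set.finite_range fun p : K.facets × (Fin (d - 1) → Fin n) × Fin (d - 1 + 1) =>
      (1 / ‖edgewiseVertex (σ p.1) p.2.1 p.2.2‖) • edgewiseVertex (σ p.1) p.2.1 p.2.2).subset ?_
    rintro _ ⟨s, r, j, rfl⟩
    exact ⟨(s, r, j), rfl⟩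
  · rw [StrictConvexSpace.extremePoints_closedBall_eq_sphere]
    rintro _ ⟨s, r, j, rfl⟩
    rw [mem_sphere_zero_iff_norm, one_div]
    exact norm_smul_inv_norm (hv0 s r j)
  · exact hsub ⟨0, by simp, smul_zero _⟩
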